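/- Let $L>1$ and $k>1$ be integers, let $\mathbb N=\{0,1,2,\dots\}$, and let $\kappa:\{1,\dots,k-1\}\times\mathbb N\to\{0,\dots,L-1\}$ be a map. Let $a_0,\dots,a_{L-1}$ be $L$ distinct complex numbers, with indices read modulo $L$, and let $f$ be the morphism on words over $\{a_0,\dots,a_{L-1}\}$ with $f(a_i)=a_{i+1}$. Put $A_0=a_0$ and $$A_{n+1}=A_n\,f^{\kappa(1,n)}(A_n)\cdots f^{\kappa(k-1,n)}(A_n)\qquad(n\ge 0),$$ and let $(a(n))_{n\ge 0}=\lim_{n\to\infty}A_n$ be the infinite word that has every $A_n$ as a prefix (a generalized Thue–Morse sequence of type $(L,k,\kappa)$, or $(L,k,\kappa)$-TM sequence). Let $\beta>1$ be an integer and suppose that $a(n)\in\{0,1,\dots,\beta-1\}$ for all $n\ge 0$. Suppose that there is no integer $A\ge 0$ such that $$\kappa(s,A+y)\equiv\kappa(1,A)\,s\,k^{y}\pmod L\qquad\text{for all }1\le s\le k-1\text{ and all }y\in\mathbb N.$$ Then for all integers $N\ge 0$ and $l>0$ the series $$F(z)=\sum_{n=0}^{\infty}\frac{a(N+nl)}{z^{n+1}}\in\mathbb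 C((z^{-1}))$$ is transcendental over $\mathbb C(z)$. -/

import Mathlib

/-- The finite words `A₀, A₁, A₂, …` of the construction, over the alphabet of indices modulo `L`
(the index `i : ZMod L` stands for the letter `a_i`, so that the morphism `f (a_i) = a_{i+1}`
is `i ↦ i + 1`, and its `j`-fold composition acts letterwise):
`A₀ = a₀` and `A_{n+1} = A_n f^{κ(1,n)}(A_n) ⋯ f^{κ(k-1,n)}(A_n)`. -/
def tmWord (L k : ℕ) (κ : ℕ → ℕ → ℕ) : ℕ → List (ZMod L)
  | 0 => [0]
  | n + 1 => tmWord L k κ n ++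
      (List.range' 1 (k - 1)).flatMap fun s =>
        (tmWord L k κ n).map (fun i : ZMod L => i + 1)^[κ s n]

/-- `a` is a generalized Thue-Morse sequence of type `(L, k, κ)`: for some choice of `L` distinct
complex numbers `a_0, …, a_{L-1}` (indexed modulo `L`), it is the limit of the words `A_m`, that is,
for each `n` the `n`-th letter of `A_m` is `a n` as soon as `m` is large enough. -/
def IsTMSequence (L k : ℕ) (κ : ℕ → ℕ → ℕ) (a : ℕ → ℂ) : Prop :=
  ∃ letter : ZMod L → ℂ, Function.Injective letter ∧
    ∀ n : ℕ, ∀ᶠ m : ℕ in Filter.atTop, ((tmWord L k κ m).map letter)[n]? = some (a n)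

/-- The indeterminate `z` of the field `ℂ((z⁻¹))` of formal Laurent series in `z⁻¹`.
Mathlib's `LaurentSeries ℂ` is used with its variable `single 1 1` in the role of `z⁻¹`. -/
noncomputable def zVar : LaurentSeries ℂ := HahnSeries.single (-1 : ℤ) (1 : ℂ)

/-- The field `ℂ(z)`, as the subfield of `ℂ((z⁻¹))` generated by `z` over `ℂ`. -/
noncomputable abbrev ratFieldZ : IntermediateField ℂ (LaurentSeries ℂ) :=
  IntermediateField.adjoin ℂ {zVar}

/-- The series `∑_{n ≥ 0} b(n) z^{-n-1} = z⁻¹ ∑_{n ≥ 0} b(n) (z⁻¹)^n` in `ℂ((z⁻¹))`. -/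
noncomputable def genSeries (b : ℕ → ℂ) : LaurentSeries ℂ :=
  zVar⁻¹ * HahnSeries.ofPowerSeries ℤ ℂ (PowerSeries.mk b)

/-!
The letter at position `n` of the sequence is determined by the weight of `n`, a sum over the
base-`k` digits of `n` of contributions `κ (digit, position)` modulo `L` (`tmWord_eq_map_weight`).
Two facts about it give the theorem.

An algebraic series `F = ∑ b(n) z^{-n-1}` whose coefficients take finitely many values has
eventually periodic coefficients. In characteristic zero the field `ℂ(z)(F)` is stable under the
Euler derivation and of finite degree, so `F` satisfies a linear differential equation with
polynomial coefficients (`exists_euler_equation`). On coefficients this is a linear recurrence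
whose coefficients are polynomials in `n`. Divided by the highest power of `n`, it says that a
fixed nontrivial linear combination of `b(n), …, b(n + m)` tends to zero. This combination takes
finitely many values, so it vanishes for large `n` (`eventually_sum_eq_zero_of_euler_equation`),
and a linear recurrence with constant coefficients on finitely many values forces periodicity
(`exists_period_of_linear_recurrence`).

If `a(N + nl)` is eventually periodic, the weight is constant on an arithmetic progression of some
difference `M`. Prescribing low digits to reach the progression shows that the weights with
positions shifted by a large `j` are `M`-periodic. As `M`-periodic functions compatible with
concatenation of digits, they are additive, at least after `j` is increased by an exponent `φ`
such that `k ^ φ` is idempotent modulo `M`. Additivity at `k ^ y * s` is the excluded congruence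
(`exists_modEq_kappa_of_const_on_progression`).
-/

open Polynomial Filter Topology

/-! ### Digit weights and generalized Thue-Morse words -/

/-- The sum of `κ (d_y, j + y)` modulo `L` over the `m` lowest base-`k` digits `d_y` of `n`. A digit
`0` contributes `0`, whatever the values `κ 0 _`. -/
def digitSum (L k : ℕ) (κ : ℕ → ℕ → ℕ) (j m n : ℕ) : ZMod L :=
  ∑ y ∈ Finset.range m, if n / k ^ y % k = 0 then 0 else (κ (n / k ^ y % k) (j + y) : ZMod L)

theorem digitSum_zero (L k : ℕ) (κ : ℕ → ℕ → ℕ) (j m : ℕ) : digitSum L k κ j m 0 = 0 := by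
  simp [digitSum]

/-- Concatenation rule: the base-`k` digits of `u + k ^ t * v`, for `u < k ^ t`, are those of `u`
followed by those of `v` in positions shifted by `t`. -/
theorem digitSum_concat (L : ℕ) {k : ℕ} (hk : 0 < k) (κ : ℕ → ℕ → ℕ) (j t m v : ℕ) {u : ℕ}
    (hu : u < k ^ t) :
    digitSum L k κ j (t + m) (u + k ^ t * v) =
      digitSum L k κ j t u + digitSum L k κ (j + t) m v := by
  unfold digitSum
  rw [Finset.sum_range_add]
  congr 1
  · refine Finset.sum_congr rfl fun y hy => ?_
    obtain ⟨d, rfl⟩ := Nat.exists_eq_add_of_lt (Finset.mem_range.1 hy)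
    have : (u + k ^ (y + d + 1) * v) / k ^ y % k = u / k ^ y % k := by
      rw [show u + k ^ (y + d + 1) * v = u + k ^ y * (k * (k ^ d * v)) by ring,
        Nat.add_mul_div_left _ _ (pow_pos hk y), Nat.add_mul_mod_self_left]
    rw [this]
  · refine Finset.sum_congr rfl fun y _ => ?_
    have : (u + k ^ t * v) / k ^ (t + y) = v / k ^ y := by
      rw [pow_add, ← Nat.div_div_eq_div_mul, Nat.add_mul_div_left _ _ (pow_pos hk t),
        Nat.div_eq_of_lt hu, zero_add]
    rw [this, add_assoc]

theorem digitSum_eq_of_lt (L : ℕ) {k : ℕ} (hk : 0 < k) (κ : ℕ → ℕ → ℕ) (j : ℕ) {m m' n : ℕ}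
    (hn : n < k ^ m) (hm : m ≤ m') : digitSum L k κ j m' n = digitSum L k κ j m n := by
  obtain ⟨d, rfl⟩ := Nat.exists_eq_add_of_le hm
  simpa [digitSum_zero] using digitSum_concat L hk κ j m d 0 hn

/-- The sum of `κ (d_y, j + y)` modulo `L` over all base-`k` digits `d_y` of `n`. The `n` lowest
digits include all the nonzero ones, since `n < k ^ n`. -/
def weight (L k : ℕ) (κ : ℕ → ℕ → ℕ) (j n : ℕ) : ZMod L := digitSum L k κ j n n

theorem weight_eq_digitSum (L : ℕ) {k : ℕ} (hk : 1 < k) (κ : ℕ → ℕ → ℕ) (j : ℕ) {m n : ℕ}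
    (hn : n < k ^ m) : weight L k κ j n = digitSum L k κ j m n := by
  have hk0 : 0 < k := by omega
  rw [weight, ← digitSum_eq_of_lt L hk0 κ j (Nat.lt_pow_self hk) (le_max_left n m),
    digitSum_eq_of_lt L hk0 κ j hn (le_max_right n m)]

theorem weight_concat (L : ℕ) {k : ℕ} (hk : 1 < k) (κ : ℕ → ℕ → ℕ) (j v : ℕ) {t u : ℕ}
    (hu : u < k ^ t) :
    weight L k κ j (u + k ^ t * v) = weight L k κ j u + weight L k κ (j + t) v := by
  have hv : v < k ^ v := Nat.lt_pow_self hk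
  have h : u + k ^ t * v < k ^ (t + v) := by
    rw [pow_add]
    calc u + k ^ t * v < k ^ t + k ^ t * v := by omega
      _ = k ^ t * (v + 1) := by ring
      _ ≤ k ^ t * k ^ v := Nat.mul_le_mul_left _ hv
  rw [weight_eq_digitSum L hk κ j h, digitSum_concat L (by omega) κ j t v v hu,
    weight_eq_digitSum L hk κ j hu, weight_eq_digitSum L hk κ _ hv]

theorem weight_mul_pow (L : ℕ) {k : ℕ} (hk : 1 < k) (κ : ℕ → ℕ → ℕ) (j t v : ℕ) :
    weight L k κ j (k ^ t * v) = weight L k κ (j + t) v := by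
  have h := weight_concat L hk κ j v (t := t) (u := 0) (by positivity)
  rwa [zero_add, show weight L k κ j 0 = 0 from digitSum_zero L k κ j 0, zero_add] at h

theorem weight_digit (L : ℕ) {k : ℕ} (hk : 1 < k) (κ : ℕ → ℕ → ℕ) (j : ℕ) {s : ℕ} (hs : 1 ≤ s)
    (hsk : s < k) : weight L k κ j s = κ s j := by
  rw [weight_eq_digitSum L hk κ j (m := 1) (by simpa using hsk)]
  simp [digitSum, Nat.mod_eq_of_lt hsk, show s ≠ 0 by omega]

theorem iterate_add_one {L : ℕ} (c : ℕ) (x : ZMod L) : (fun i : ZMod L => i + 1)^[c] x = x + c := by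
  simp

/-- The letter at position `n` of a generalized Thue-Morse word has index `weight L k κ 0 n`. -/
theorem tmWord_eq_map_weight (L : ℕ) {k : ℕ} (hk : 1 < k) (κ : ℕ → ℕ → ℕ) (m : ℕ) :
    tmWord L k κ m = (List.range (k ^ m)).map (weight L k κ 0) := by
  induction m with
  | zero => simp [tmWord, weight, digitSum]
  | succ m ih =>
    -- The first `r + 1` of the `k` blocks of the next word.
    have key : ∀ r : ℕ, r + 1 ≤ k →
        (List.range (k ^ m)).map (weight L k κ 0) ++ (List.range' 1 r).flatMap (fun s =>
          ((List.range (k ^ m)).map (weight L k κ 0)).map (fun i : ZMod L => i + 1)^[κ s m]) =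
        (List.range (k ^ m * (r + 1))).map (weight L k κ 0) := by
      intro r
      induction r with
      | zero => simp
      | succ r ihr =>
        intro hr
        rw [List.range'_concat, List.flatMap_append, ← List.append_assoc, ihr (by omega),
          Nat.mul_succ (k ^ m) (r + 1), List.range_add, List.map_append]
        congr 1
        simp only [List.flatMap_cons, List.flatMap_nil, List.append_nil, List.map_map]
        refine List.map_congr_left fun u hu => ?_
        rw [List.mem_range] at hu
        simp only [Function.comp_apply]
        rw [add_comm (k ^ m * _) u, weight_concat L hk κ 0 _ hu, iterate_add_one,
          zero_add, weight_digit L hk κ m (s := r + 1) (by omega) (by omega), one_mul, add_comm 1 r]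
    rw [tmWord, ih, key (k - 1) (by omega), Nat.sub_add_cancel hk.le, pow_succ]

theorem exists_letter_weight {L k : ℕ} (hk : 1 < k) {κ : ℕ → ℕ → ℕ} {a : ℕ → ℂ}
    (ha : IsTMSequence L k κ a) :
    ∃ letter : ZMod L → ℂ, Function.Injective letter ∧
      ∀ n, a n = letter (weight L k κ 0 n) := by
  obtain ⟨letter, hinj, h⟩ := ha
  refine ⟨letter, hinj, fun n => ?_⟩
  obtain ⟨m, hm, hnm⟩ := ((h n).and (Filter.eventually_ge_atTop n)).exists
  have hn : n < k ^ m := (Nat.lt_pow_self hk).trans_le (Nat.pow_le_pow_right (by omega) hnm)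
  rw [tmWord_eq_map_weight L hk] at hm
  simpa [hn, eq_comm] using hm

/-- Some positive power of `k` is idempotent modulo `M`. -/
theorem exists_idempotent_pow_modEq (k : ℕ) {M : ℕ} (hM : 0 < M) :
    ∃ φ : ℕ, 0 < φ ∧ ∀ n : ℕ, k ^ (φ * (n + 1)) ≡ k ^ φ [MOD M] := by
  have : NeZero M := ⟨hM.ne'⟩
  obtain ⟨p, p', hne, heq⟩ := Finite.exists_ne_map_eq_of_infinite fun i : ℕ => (k : ZMod M) ^ i
  wlog hlt : p < p' generalizing p p'
  · exact this p' p hne.symm heq.symm (by omega)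
  obtain ⟨q, rfl⟩ := Nat.exists_eq_add_of_lt hlt
  have hstep : ∀ d c : ℕ, (k : ZMod M) ^ (p + d + (q + 1) * c) = (k : ZMod M) ^ (p + d) := by
    intro d c
    induction c with
    | zero => simp
    | succ c ih =>
      rw [← ih, show p + d + (q + 1) * (c + 1) = p + q + 1 + (d + (q + 1) * c) by ring, pow_add,
        ← heq, ← pow_add]
      ring
  refine ⟨(p + 1) * (q + 1), by positivity, fun n => ?_⟩
  rw [← ZMod.natCast_eq_natCast_iff]
  push_cast
  rw [show (p + 1) * (q + 1) * (n + 1) =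
      p + (p * q + q + 1) + (q + 1) * ((p + 1) * n) by ring, hstep]
  ring

/-- A digit weight that is constant on an arithmetic progression has the exceptional form. Its
shifts `weight L k κ j` are periodic for large `j`, and periodicity combined with the digit
concatenation rule makes them additive, so `weight L k κ j v = v * weight L k κ j 1`. -/
theorem exists_modEq_kappa_of_const_on_progression {L k : ℕ} (hk : 1 < k) (κ : ℕ → ℕ → ℕ)
    {N M : ℕ} (hM : 0 < M) {c : ZMod L} (hc : ∀ n, weight L k κ 0 (N + n * M) = c) :
    ∃ A : ℕ, ∀ s y : ℕ, 1 ≤ s → s ≤ k - 1 → κ s (A + y) ≡ κ 1 A * s * k ^ y [MOD L] := by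
  have hk0 : 0 < k := by omega
  have hper : ∀ j, N + M ≤ j → ∀ v, weight L k κ j (v + M) = weight L k κ j v := by
    intro j hj v
    have hjk : N + M < k ^ j := hj.trans_lt (Nat.lt_pow_self hk)
    -- Low digits `u` that put `u + k ^ j * v` on the progression; they serve for `v + M` too.
    obtain ⟨u, hu, n, hn⟩ : ∃ u, u < k ^ j ∧ ∃ n, u + k ^ j * v = N + n * M := by
      have hr := Nat.mod_lt (k ^ j * v) hM
      have hd := Nat.mod_add_div (k ^ j * v) M
      refine ⟨N + (M - k ^ j * v % M), by omega, 1 + k ^ j * v / M, ?_⟩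
      rw [add_mul, one_mul, mul_comm _ M]
      omega
    have h1 := hc n
    have h2 := hc (n + k ^ j)
    rw [← hn, weight_concat L hk κ 0 v hu] at h1
    rw [show N + (n + k ^ j) * M = u + k ^ j * (v + M) by linear_combination -hn,
      weight_concat L hk κ 0 _ hu, ← h1] at h2
    simpa using h2
  have hmod : ∀ j, N + M ≤ j → ∀ v w, v ≡ w [MOD M] → weight L k κ j v = weight L k κ j w := by
    intro j hj v w hvw
    have hp : Function.Periodic (weight L k κ j) M := hper j hj
    rw [← hp.map_mod_nat v, ← hp.map_mod_nat w, hvw]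
  obtain ⟨φ, hφ0, hφ⟩ := exists_idempotent_pow_modEq k hM
  set j := N + M
  have hadd : ∀ u v, weight L k κ (j + φ) (u + v) =
      weight L k κ (j + φ) u + weight L k κ (j + φ) v := by
    intro u v
    simp only [← weight_mul_pow L hk κ j φ]
    -- Replace the second summand by a congruent multiple of a power of `k` so high that its digits
    -- lie above those of the first one.
    have hu : k ^ φ * u < k ^ (φ * (k ^ φ * u + 1)) :=
      (Nat.lt_pow_self hk).trans_le (Nat.pow_le_pow_right hk0
        ((Nat.le_succ _).trans (Nat.le_mul_of_pos_left _ hφ0)))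
    have hv := (hφ (k ^ φ * u)).mul_right v
    rw [hmod j le_rfl _ _ hv.symm, weight_mul_pow L hk κ j _ v, ← weight_concat L hk κ j v hu]
    refine hmod j le_rfl _ _ ?_
    rw [mul_add]
    exact hv.symm.add_left _
  have hlin : ∀ v, weight L k κ (j + φ) v = v * weight L k κ (j + φ) 1 := by
    intro v
    induction v with
    | zero => simp [weight, digitSum]
    | succ v ih => rw [hadd, ih]; push_cast; ring
  refine ⟨j + φ, fun s y hs hsk => ?_⟩
  rw [← ZMod.natCast_eq_natCast_iff]
  have h := hlin (k ^ y * s)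
  rw [weight_mul_pow L hk, weight_digit L hk κ _ hs (by omega),
    weight_digit L hk κ _ le_rfl hk] at h
  rw [h]; push_cast; ring

/-! ### The Euler derivation on algebraic Laurent series -/

theorem isPWO_support_index_mul_coeff (x : LaurentSeries ℂ) :
    (Function.support fun n : ℤ => (n : ℂ) * x.coeff n).IsPWO :=
  x.isPWO_support.mono fun _ hn => right_ne_zero_of_mul hn

/-- The Euler operator on `ℂ((X))`, `X = z⁻¹`, which multiplies the coefficient of `X ^ n` by `n`.
It is `X d/dX`, a derivation; it is recorded as an additive map only, with the Leibniz rule in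
`eulerDerivation_mul`. -/
noncomputable def eulerDerivation : LaurentSeries ℂ →+ LaurentSeries ℂ where
  toFun x := ⟨fun n => (n : ℂ) * x.coeff n, isPWO_support_index_mul_coeff x⟩
  map_zero' := by ext n; simp
  map_add' x y := by ext n; simp [mul_add]

theorem eulerDerivation_coeff (x : LaurentSeries ℂ) (n : ℤ) :
    (eulerDerivation x).coeff n = n * x.coeff n := rfl

theorem eulerDerivation_mul (x y : LaurentSeries ℂ) :
    eulerDerivation (x * y) = x * eulerDerivation y + y * eulerDerivation x := by
  have hx : (eulerDerivation x).support ⊆ x.support := fun n hn => right_ne_zero_of_mul hn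
  have hy : (eulerDerivation y).support ⊆ y.support := fun n hn => right_ne_zero_of_mul hn
  ext n
  rw [mul_comm y, HahnSeries.coeff_add, eulerDerivation_coeff, HahnSeries.coeff_mul,
    HahnSeries.coeff_mul_right' y.isPWO_support hy, HahnSeries.coeff_mul_left' x.isPWO_support hx,
    Finset.mul_sum, ← Finset.sum_add_distrib]
  refine Finset.sum_congr rfl fun p hp => ?_
  have hp : p.1 + p.2 = n := by simp_all
  rw [eulerDerivation_coeff, eulerDerivation_coeff, ← hp]
  push_cast
  ring

theorem eulerDerivation_one : eulerDerivation 1 = 0 := by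
  have h := eulerDerivation_mul 1 1
  simpa using h

theorem eulerDerivation_inv (x : LaurentSeries ℂ) :
    eulerDerivation x⁻¹ = -x⁻¹ ^ 2 * eulerDerivation x := by
  by_cases hx : x = 0
  · simp [hx]
  have h := eulerDerivation_mul x x⁻¹
  rw [mul_inv_cancel₀ hx, eulerDerivation_one] at h
  field_simp at h ⊢
  linear_combination -h

theorem eulerDerivation_pow (x : LaurentSeries ℂ) (n : ℕ) :
    eulerDerivation (x ^ n) = n * x ^ (n - 1) * eulerDerivation x := by
  induction n with
  | zero => simp [eulerDerivation_one]
  | succ n ih =>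
    rw [pow_succ, eulerDerivation_mul, ih]
    cases n with
    | zero => simp
    | succ n => simp only [Nat.add_sub_cancel]; push_cast; ring

theorem eulerDerivation_iterate_coeff (x : LaurentSeries ℂ) (j : ℕ) (n : ℤ) :
    (eulerDerivation^[j] x).coeff n = n ^ j * x.coeff n := by
  induction j with
  | zero => simp
  | succ j ih => rw [Function.iterate_succ_apply', eulerDerivation_coeff, ih]; ring

theorem laurentSeries_algebraMap_eq_single (c : ℂ) :
    algebraMap ℂ (LaurentSeries ℂ) c = HahnSeries.single 0 c := by
  rw [HahnSeries.algebraMap_apply']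
  simp

theorem eulerDerivation_single (m : ℤ) (c : ℂ) :
    eulerDerivation (HahnSeries.single m c) = HahnSeries.single m (m * c) := by
  ext n
  rw [eulerDerivation_coeff]
  by_cases h : n = m
  · subst h; simp
  · simp [HahnSeries.coeff_single_of_ne h]

/-- A field generated by `S` over `K` is stable under the Euler operator as soon as the operator
maps `K` and `S` into it. -/
theorem eulerDerivation_mem_adjoin {K : Type*} [Field K] [Algebra K (LaurentSeries ℂ)]
    {S : Set (LaurentSeries ℂ)}
    (hK : ∀ c : K, eulerDerivation (algebraMap K _ c) ∈ IntermediateField.adjoin K S)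
    (hS : ∀ x ∈ S, eulerDerivation x ∈ IntermediateField.adjoin K S) {x : LaurentSeries ℂ}
    (hx : x ∈ IntermediateField.adjoin K S) :
    eulerDerivation x ∈ IntermediateField.adjoin K S := by
  induction hx using IntermediateField.adjoin_induction with
  | mem x hx => exact hS x hx
  | algebraMap c => exact hK c
  | add x y _ _ hx hy => rw [map_add]; exact add_mem hx hy
  | inv x hxm hx =>
    rw [eulerDerivation_inv]
    exact mul_mem (neg_mem (pow_mem (inv_mem hxm) 2)) hx
  | mul x y hxm hym hx hy =>
    rw [eulerDerivation_mul]
    exact add_mem (mul_mem hxm hy) (mul_mem hym hx)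

theorem eulerDerivation_mem_ratFieldZ {x : LaurentSeries ℂ} (hx : x ∈ ratFieldZ) :
    eulerDerivation x ∈ ratFieldZ := by
  refine eulerDerivation_mem_adjoin (fun c => ?_) (fun x hx => ?_) hx
  · rw [laurentSeries_algebraMap_eq_single, eulerDerivation_single]
    simp
  · rw [Set.mem_singleton_iff.1 hx, zVar, eulerDerivation_single]
    have : HahnSeries.single (-1 : ℤ) (((-1 : ℤ) : ℂ) * 1) = -zVar := by
      simp [zVar]
    rw [this]
    exact neg_mem (IntermediateField.mem_adjoin_simple_self ℂ zVar)

open IntermediateField in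
/-- The field `ℂ(z)(F)` is stable under the Euler operator when `F` is algebraic: differentiating
the equation of `F` given by its minimal polynomial `P` expresses the derivative of `F` as an
element of `ℂ(z)(F)` divided by `P'(F)`, which is nonzero in characteristic zero. -/
theorem eulerDerivation_mem_of_isAlgebraic {F : LaurentSeries ℂ} (hF : IsAlgebraic ratFieldZ F)
    {x : LaurentSeries ℂ} (hx : x ∈ ratFieldZ⟮F⟯) : eulerDerivation x ∈ ratFieldZ⟮F⟯ := by
  have hK : ∀ c : ratFieldZ, eulerDerivation (algebraMap ratFieldZ _ c) ∈ ratFieldZ⟮F⟯ := fun c =>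
    algebraMap_mem _ (⟨_, eulerDerivation_mem_ratFieldZ c.2⟩ : ratFieldZ)
  have haeval : ∀ p : ratFieldZ[X], aeval F p ∈ ratFieldZ⟮F⟯ := fun p =>
    algebra_adjoin_le_adjoin _ _ (aeval_mem_adjoin_singleton _ F)
  -- The chain rule, with the derivatives of the coefficients of `p` collected in `r`.
  have hchain : ∀ p : ratFieldZ[X], ∃ r ∈ ratFieldZ⟮F⟯,
      eulerDerivation (aeval F p) = r + aeval F (derivative p) * eulerDerivation F := by
    intro p
    induction p using Polynomial.induction_on' with
    | add p q hp hq =>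
      obtain ⟨r, hr, hp⟩ := hp
      obtain ⟨t, ht, hq⟩ := hq
      refine ⟨r + t, add_mem hr ht, ?_⟩
      simp only [map_add, hp, hq]; ring
    | monomial n c =>
      refine ⟨F ^ n * eulerDerivation (algebraMap ratFieldZ _ c),
        mul_mem (pow_mem (mem_adjoin_simple_self _ F) n) (hK c), ?_⟩
      simp only [aeval_monomial, derivative_monomial, eulerDerivation_mul, eulerDerivation_pow,
        map_mul, map_natCast]
      ring
  refine eulerDerivation_mem_adjoin hK (fun x hx => ?_) hx
  obtain rfl := Set.mem_singleton_iff.1 hx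
  have hint := hF.isIntegral
  obtain ⟨r, hr, h⟩ := hchain (minpoly ratFieldZ x)
  have hne : aeval x (derivative (minpoly ratFieldZ x)) ≠ 0 :=
    (minpoly.irreducible hint).separable.aeval_derivative_ne_zero (minpoly.aeval _ _)
  rw [minpoly.aeval, map_zero] at h
  have : eulerDerivation x = -r / aeval x (derivative (minpoly ratFieldZ x)) := by
    rw [eq_div_iff hne]; linear_combination -h
  rw [this]
  exact div_mem (neg_mem hr) (haeval _)

/-- Elements of `ℂ(z)` are quotients of polynomials in `z`, so finitely many of them have a common
denominator. -/
theorem exists_common_denominator (s : Finset ℕ) (g : ℕ → ratFieldZ) :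
    ∃ w : LaurentSeries ℂ, w ≠ 0 ∧
      ∀ j ∈ s, ∃ q : ℂ[X], aeval zVar q = w * (g j : LaurentSeries ℂ) := by
  have hdiv : ∀ x ∈ ratFieldZ, ∃ r d : ℂ[X],
      aeval zVar d ≠ 0 ∧ aeval zVar d * x = aeval zVar r := by
    intro x hx
    obtain ⟨r, d, rfl⟩ := (IntermediateField.mem_adjoin_simple_iff ℂ x).1 hx
    -- If the denominator vanishes, the quotient is the junk value `0`.
    by_cases hd : aeval zVar d = 0
    · exact ⟨0, 1, by simp, by simp [hd]⟩
    · exact ⟨r, d, hd, mul_div_cancel₀ _ hd⟩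
  choose r d hd hrd using fun j => hdiv (g j) (g j).2
  refine ⟨∏ j ∈ s, aeval zVar (d j), Finset.prod_ne_zero_iff.2 fun j _ => hd j, fun j hj =>
    ⟨(∏ i ∈ s.erase j, d i) * r j, ?_⟩⟩
  rw [← Finset.prod_erase_mul s _ hj, map_mul, map_prod, ← hrd, mul_assoc]

open IntermediateField in
/-- An algebraic Laurent series satisfies a linear differential equation with polynomial
coefficients: its iterated derivatives lie in the finite-dimensional `ℂ(z)`-space `ℂ(z)(F)`. -/
theorem exists_euler_equation {F : LaurentSeries ℂ} (hF : IsAlgebraic ratFieldZ F) :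
    ∃ (D : ℕ) (q : ℕ → ℂ[X]), q D ≠ 0 ∧
      ∑ j ∈ Finset.range (D + 1), aeval zVar (q j) * eulerDerivation^[j] F = 0 := by
  have hfin : FiniteDimensional ratFieldZ ratFieldZ⟮F⟯ := adjoin.finiteDimensional hF.isIntegral
  have hmem : ∀ j, eulerDerivation^[j] F ∈ ratFieldZ⟮F⟯ := fun j => by
    induction j with
    | zero => exact mem_adjoin_simple_self _ F
    | succ j ih =>
      rw [Function.iterate_succ_apply']
      exact eulerDerivation_mem_of_isAlgebraic hF ih
  have hdep : ¬ LinearIndependent ratFieldZ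
      (fun j : ℕ => (⟨eulerDerivation^[j] F, hmem j⟩ : ratFieldZ⟮F⟯)) := fun h =>
    not_finite_iff_infinite.2 inferInstance h.finite
  obtain ⟨s, g, hsum, i, hi, hgi⟩ := not_linearIndependent_iff.1 hdep
  obtain ⟨w, hw, hq⟩ := exists_common_denominator s g
  choose! q hq using hq
  have hsum' : ∑ j ∈ s, aeval zVar (q j) * eulerDerivation^[j] F = 0 := by
    have h := congrArg (fun x : ratFieldZ⟮F⟯ => w * (x : LaurentSeries ℂ)) hsum
    simp only [AddSubmonoidClass.coe_finsetSum, Finset.mul_sum, ZeroMemClass.coe_zero,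
      mul_zero] at h
    rw [← h]
    refine Finset.sum_congr rfl fun j hj => ?_
    rw [hq j hj, mul_assoc]
    rfl
  have hqi : q i ≠ 0 := fun h0 => by
    have := hq i hi
    rw [h0, map_zero] at this
    exact mul_ne_zero hw (by simpa using hgi) this.symm
  set t := s.filter fun j => q j ≠ 0 with ht
  have hne : t.Nonempty := ⟨i, by simp [ht, hi, hqi]⟩
  refine ⟨t.max' hne, fun j => if j ∈ t then q j else 0, ?_, ?_⟩
  · beta_reduce
    rw [if_pos (t.max'_mem hne)]
    exact (Finset.mem_filter.1 (t.max'_mem hne)).2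
  · rw [← hsum', ← Finset.sum_filter_of_ne (s := s) (p := fun j => q j ≠ 0)]
    · symm
      refine Finset.sum_subset_zero_on_sdiff (fun j hj => ?_) (fun j hj => ?_) (fun j hj => ?_)
      · exact Finset.mem_range.2 (Nat.lt_succ_of_le (t.le_max' j hj))
      · beta_reduce
        rw [if_neg (Finset.mem_sdiff.1 hj).2, map_zero, zero_mul]
      · beta_reduce
        rw [if_pos hj]
    · intro j _ hj h0
      simp [h0] at hj

/-- Multiplication by a polynomial in `z` shifts indices upwards, as `z` is `X⁻¹`. -/
theorem aeval_zVar_mul_coeff (q : ℂ[X]) (G : LaurentSeries ℂ) (n : ℤ) :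
    (aeval zVar q * G).coeff n = q.sum fun i c => c * G.coeff (n + i) := by
  have hpow : ∀ i : ℕ, zVar ^ i = HahnSeries.single (-(i : ℤ)) 1 := fun i => by
    simp [zVar, HahnSeries.single_pow]
  rw [aeval_eq_sum_range, Finset.sum_mul, sum_over_range _ (by simp)]
  simp only [HahnSeries.coeff_sum]
  refine Finset.sum_congr rfl fun i _ => ?_
  rw [Algebra.smul_def, laurentSeries_algebraMap_eq_single, hpow, HahnSeries.single_mul_single,
    HahnSeries.coeff_single_mul]
  simp

theorem genSeries_coeff (b : ℕ → ℂ) (n : ℕ) : (genSeries b).coeff (n + 1 : ℤ) = b n := by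
  have : zVar⁻¹ = HahnSeries.single (1 : ℤ) (1 : ℂ) := by
    simp [zVar]
  rw [genSeries, this, HahnSeries.coeff_single_mul]
  simp [HahnSeries.ofPowerSeries_apply_coeff]

/-! ### Recurrences for sequences with finitely many values -/

/-- Comparing the terms of highest degree in `n` in the recurrence with polynomial coefficients
given by a differential equation. For a sequence with finitely many values, the highest terms
already cancel on their own, up to finitely many exceptions. -/
theorem eventually_sum_eq_zero_of_euler_equation {b : ℕ → ℂ} (hb : (Set.range b).Finite) {D : ℕ}
    {q : ℕ → ℂ[X]}
    (h : ∀ n : ℕ, ∑ j ∈ Finset.range (D + 1), ∑ i ∈ Finset.range ((q j).natDegree + 1),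
      (q j).coeff i * (((n : ℂ) + (i + 1 : ℕ)) ^ j * b (n + i)) = 0) :
    ∀ᶠ n in atTop, ∑ i ∈ Finset.range ((q D).natDegree + 1), (q D).coeff i * b (n + i) = 0 := by
  obtain ⟨B, hB⟩ := hb.isBounded.exists_norm_le
  have hB : ∀ n, ‖b n‖ ≤ B := fun n => hB _ ⟨n, rfl⟩
  have hinv : Tendsto (fun n : ℕ => ((n : ℂ))⁻¹) atTop (𝓝 0) := tendsto_inv_atTop_nhds_zero_nat
  have hratio : ∀ i : ℕ, Tendsto (fun n : ℕ => ((n : ℂ) + i) * (n : ℂ)⁻¹) atTop (𝓝 1) := by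
    intro i
    have h1 : Tendsto (fun n : ℕ => 1 + (i : ℂ) * (n : ℂ)⁻¹) atTop (𝓝 (1 + i * 0)) :=
      tendsto_const_nhds.add (hinv.const_mul _)
    rw [mul_zero, add_zero] at h1
    refine h1.congr' ?_
    filter_upwards [eventually_gt_atTop 0] with n hn
    have : (n : ℂ) ≠ 0 := by exact_mod_cast hn.ne'
    field_simp
  have hlow : ∀ i j : ℕ, j < D →
      Tendsto (fun n : ℕ => ((n : ℂ) + (i + 1 : ℕ)) ^ j * (n : ℂ)⁻¹ ^ D * b (n + i))
        atTop (𝓝 0) := by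
    intro i j hj
    obtain ⟨e, rfl⟩ := Nat.exists_eq_add_of_lt hj
    have h1 := ((hratio (i + 1)).pow j).mul (hinv.pow (e + 1))
    rw [zero_pow (by omega), mul_zero] at h1
    simp only [mul_pow] at h1
    refine (h1.zero_mul_isBoundedUnder_le
      (isBoundedUnder_of ⟨B, fun n => hB (n + i)⟩)).congr fun n => ?_
    ring
  have htop : ∀ i : ℕ,
      Tendsto (fun n : ℕ => (((n : ℂ) + (i + 1 : ℕ)) ^ D * (n : ℂ)⁻¹ ^ D - 1) * b (n + i))
      atTop (𝓝 0) := by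
    intro i
    have h1 := ((hratio (i + 1)).pow D).sub_const 1
    rw [one_pow, sub_self] at h1
    simp only [mul_pow] at h1
    refine (h1.zero_mul_isBoundedUnder_le
      (isBoundedUnder_of ⟨B, fun n => hB (n + i)⟩)).congr fun n => ?_
    ring
  set S : ℕ → ℂ := fun n => ∑ i ∈ Finset.range ((q D).natDegree + 1), (q D).coeff i * b (n + i)
  have hS : Tendsto S atTop (𝓝 0) := by
    have h1 : Tendsto (fun n : ℕ =>
        -(∑ j ∈ Finset.range D, ∑ i ∈ Finset.range ((q j).natDegree + 1),
          (q j).coeff i * (((n : ℂ) + (i + 1 : ℕ)) ^ j * (n : ℂ)⁻¹ ^ D * b (n + i)) +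
        ∑ i ∈ Finset.range ((q D).natDegree + 1),
          (q D).coeff i * ((((n : ℂ) + (i + 1 : ℕ)) ^ D * (n : ℂ)⁻¹ ^ D - 1) * b (n + i)))) atTop
        (𝓝 (-(∑ j ∈ Finset.range D, ∑ i ∈ Finset.range ((q j).natDegree + 1),
          (q j).coeff i * 0 + ∑ i ∈ Finset.range ((q D).natDegree + 1), (q D).coeff i * 0))) := by
      refine ((tendsto_finsetSum _ fun j hj => tendsto_finsetSum _ fun i _ => ?_).add
        (tendsto_finsetSum _ fun i _ => (htop i).const_mul _)).neg
      exact (hlow i j (Finset.mem_range.1 hj)).const_mul _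
    simp only [mul_zero, Finset.sum_const_zero, add_zero, neg_zero] at h1
    refine h1.congr fun n => ?_
    have h2 := congrArg (fun x => x * (n : ℂ)⁻¹ ^ D) (h n)
    simp only [zero_mul, Finset.sum_range_succ _ D, add_mul, Finset.sum_mul] at h2
    rw [neg_eq_iff_add_eq_zero, ← h2, add_assoc, ← Finset.sum_add_distrib]
    congr 1
    · refine Finset.sum_congr rfl fun j _ => Finset.sum_congr rfl fun i _ => ?_
      ring
    · refine Finset.sum_congr rfl fun i _ => ?_
      ring
  -- `S` takes finitely many values, so it can tend to `0` only by vanishing eventually.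
  have hfin : (Set.range S).Finite := by
    have hpi := Set.Finite.pi' (ι := Fin ((q D).natDegree + 1)) fun _ => hb
    refine (hpi.image fun x => ∑ i : Fin ((q D).natDegree + 1), (q D).coeff i * x i).subset ?_
    rintro _ ⟨n, rfl⟩
    refine ⟨fun i => b (n + i), fun i => ⟨_, rfl⟩, ?_⟩
    exact Fin.sum_univ_eq_sum_range (fun i => (q D).coeff i * b (n + i)) _
  have hopen : (Set.range S \ {0})ᶜ ∈ 𝓝 (0 : ℂ) :=
    (hfin.subset Set.sdiff_subset).isClosed.isOpen_compl.mem_nhds (by simp)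
  filter_upwards [hS hopen] with n hn
  by_contra hne
  exact hn ⟨⟨n, rfl⟩, hne⟩

/-- A sequence with finitely many values that eventually satisfies a linear recurrence with constant
coefficients is eventually periodic, by the pigeonhole principle applied to its windows. -/
theorem exists_period_of_linear_recurrence {b : ℕ → ℂ} (hb : (Set.range b).Finite) {p : ℂ[X]}
    (hp : p ≠ 0)
    (h : ∀ᶠ n in atTop, ∑ i ∈ Finset.range (p.natDegree + 1), p.coeff i * b (n + i) = 0) :
    ∃ m d : ℕ, 0 < d ∧ ∀ n, b (m + n + d) = b (m + n) := by
  obtain ⟨n₀, hn₀⟩ := eventually_atTop.1 h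
  have : Finite (Set.range b) := hb
  obtain ⟨x, y, hne, hxy⟩ := Finite.exists_ne_map_eq_of_infinite
    fun (n : ℕ) (i : Fin p.natDegree) => (⟨b (n₀ + n + i), _, rfl⟩ : Set.range b)
  wlog hlt : x < y generalizing x y
  · exact this y x hne.symm hxy.symm (by omega)
  obtain ⟨d, rfl⟩ := Nat.exists_eq_add_of_lt hlt
  refine ⟨n₀ + x, d + 1, by omega, fun n => ?_⟩
  induction n using Nat.strong_induction_on with
  | _ n ih =>
    by_cases hn : n < p.natDegree
    · have h1 := congrArg Subtype.val (congrFun hxy ⟨n, hn⟩)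
      simp only at h1
      rw [h1]
      congr 1
      ring
    · obtain ⟨t, rfl⟩ := Nat.exists_eq_add_of_le (not_lt.1 hn)
      have h1 := hn₀ (n₀ + x + t) (by omega)
      have h2 := hn₀ (n₀ + x + t + (d + 1)) (by omega)
      rw [Finset.sum_range_succ] at h1 h2
      have h3 : ∑ i ∈ Finset.range p.natDegree, p.coeff i * b (n₀ + x + t + (d + 1) + i) =
          ∑ i ∈ Finset.range p.natDegree, p.coeff i * b (n₀ + x + t + i) := by
        refine Finset.sum_congr rfl fun i hi => ?_
        rw [Finset.mem_range] at hi
        have := ih (t + i) (by omega)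
        rw [show n₀ + x + t + (d + 1) + i = n₀ + x + (t + i) + (d + 1) by ring, this, add_assoc]
        ring_nf
      rw [h3] at h2
      have h4 : p.coeff p.natDegree * b (n₀ + x + t + (d + 1) + p.natDegree) =
          p.coeff p.natDegree * b (n₀ + x + t + p.natDegree) := by
        linear_combination h2 - h1
      have h5 := mul_left_cancel₀ (by simpa using hp) h4
      rw [show n₀ + x + (p.natDegree + t) + (d + 1) = n₀ + x + t + (d + 1) + p.natDegree by ring,
        h5]
      congr 1
      ring

/-! ### Transcendence -/

/-- An algebraic series whose coefficients take finitely many values has eventually periodic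
coefficients. -/
theorem exists_period_of_isAlgebraic_genSeries {b : ℕ → ℂ} (hb : (Set.range b).Finite)
    (h : IsAlgebraic ratFieldZ (genSeries b)) :
    ∃ m d : ℕ, 0 < d ∧ ∀ n, b (m + n + d) = b (m + n) := by
  obtain ⟨D, q, hq, hsum⟩ := exists_euler_equation h
  refine exists_period_of_linear_recurrence hb hq
    (eventually_sum_eq_zero_of_euler_equation hb fun n => ?_)
  have hn := congrArg (fun x : LaurentSeries ℂ => x.coeff (n + 1 : ℤ)) hsum
  simp only [HahnSeries.coeff_sum, aeval_zVar_mul_coeff, HahnSeries.coeff_zero] at hn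
  rw [← hn]
  refine Finset.sum_congr rfl fun j _ => ?_
  rw [sum_over_range _ (by simp)]
  refine Finset.sum_congr rfl fun i _ => ?_
  rw [eulerDerivation_iterate_coeff,
    show (n + 1 + i : ℤ) = ((n + i : ℕ) : ℤ) + 1 by push_cast; ring, genSeries_coeff]
  push_cast
  ring

theorem corollary4p1 (L k : ℕ) (hL : 1 < L) (hk : 1 < k)
    (κ : ℕ → ℕ → ℕ) (hκ : ∀ s y : ℕ, 1 ≤ s → s ≤ k - 1 → κ s y ≤ L - 1)
    (a : ℕ → ℂ) (ha : IsTMSequence L k κ a)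
    (β : ℕ) (hβ : 1 < β) (hval : ∀ n : ℕ, ∃ d : ℕ, d ≤ β - 1 ∧ a n = (d : ℂ))
    (hnp : ¬ ∃ A : ℕ, ∀ s y : ℕ, 1 ≤ s → s ≤ k - 1 →
      κ s (A + y) ≡ κ 1 A * s * k ^ y [MOD L])
    (N l : ℕ) (hl : 0 < l) :
    Transcendental ratFieldZ (genSeries fun n : ℕ => a (N + n * l)) := by 
  obtain ⟨letter, hinj, haw⟩ := exists_letter_weight hk ha
  have : NeZero L := ⟨by omega⟩
  intro halg
  have hfin : (Set.range fun n : ℕ => a (N + n * l)).Finite :=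
    (Set.finite_range letter).subset (by rintro _ ⟨n, rfl⟩; exact ⟨_, (haw _).symm⟩)
  obtain ⟨m, d, hd, hper⟩ := exists_period_of_isAlgebraic_genSeries hfin halg
  refine hnp (exists_modEq_kappa_of_const_on_progression hk κ (N := N + m * l) (M := d * l)
    (Nat.mul_pos hd hl) (c := weight L k κ 0 (N + m * l)) fun n => hinj ?_)
  rw [← haw, ← haw]
  induction n with
  | zero => simp
  | succ n ih =>
    rw [← ih, show N + m * l + (n + 1) * (d * l) = N + (m + n * d + d) * l by ring,
      show N + m * l + n * (d * l) = N + (m + n * d) * l by ring]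
    exact hper (n * d)
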